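/- Let $\mathscr T$ be a finite rooted ordered binary tree (each vertex has at most two children, left or right) with edge set $E$, let $d,n\ge 1$, let $A=(\mathbb R^d)^n$ with its Euclidean norm, and let $X=\prod_{e\in E}A$, with the two metrics $d_1(x,y)=\sum_{e}\|x_e-y_e\|$ and $d_2(x,y)=\sqrt{\sum_{e}\|x_e-y_e\|^2}$. Write $x\sim y$ if the ordered attributed trees obtained from $x$ and $y$ by collapsing all edges with attribute $0$ are identical. Let $G$ be the group of automorphisms of $\mathscr T$ as a rooted unordered tree, acting on $X$ by permuting coordinates, and let $\bar{\bar X}=(X/\!\sim)/G$ be the quotient of $X$ by the equivalence relation generated by $\sim$ and the action of $G$. For $i=1,2$ let $$\bar{\bar d}_i(a,b)=\inf\Big\{\sum_{j=1}^k d_i(x_j,y_j)\Big\},$$ the infimum over all $k$ and all $x_1,y_1,\dots,x_k,y_k\in X$ such that $x_1$ represents $a$, $y_k$ represents $b$, and $y_j$ and $x_{j+1}$ represent the same point of $\bar{\bar X}$. The metric $\bar{\bar d}_2$ is called QED, and $\bar{\bar d}_1$ is called TED. A family $\mathcal E$ of subsets of $E$ which, with a set $F$, contains every $F'\subseteq E$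 that gives the same ordered tree after all other edges are collapsed, defines $Z=\bigcup_{F\in\mathcal E}\{x\in X: x_e=0\text{ for }e\notin F\}$ and the restricted space $\bar{\bar Z}\subseteq\bar{\bar X}$, the image of $Z$. (It need not be saturated with respect to $G$.) It carries the metrics $\bar{\bar d}_{Z,i}$ given by the same formula with all $x_j,y_j\in Z$ and with $d_i$ replaced by the metric that it induces on $Z$; the statement holds both for the restriction of $d_i$ to $Z$ and for the induced length metric on $Z$ (only straight segments $[x_j,y_j]\subseteq Z$ are used). A space has curvature $\le\kappa$ at a point if some open ball around the point is a $CAT(\kappa)$ space; the curvature at the point is unbounded if this holds for no $\kappa\in\mathbb R$. (i) With QED, $\bar{\bar X}$ is generically non-positively curved: there is an open dense subset at each of whose points the curvature is $\le 0$. (ii) If $|E|\ge 2$, then with TED every point $p$ of $\bar{\bar X}$ has the following properties: the curvature at $p$ is unbounded; and in no neighbourhood $U$ of $p$ are geodesics, Fréchet means, Karcher means (local minimizers of the sum of squared distances), circumcenters (centers of a smallest closed ball containing the data) or centroids unique, that is, $U$ contains two different geodesics with the same end points, and, for each of these four notions of average, a non-empty finite dataset with two different averages in $U$. Here a centroid of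 two points is the midpoint of a geodesic joining them; $c$ is a centroid of $m\ge 3$ points if there is a sequence of $m$-tuples, starting with the given one, in which each tuple consists of centroids of the $(m-1)$-element subtuples of the previous one, and whose entries all converge to $c$. (iii) For every restricted space $\bar{\bar Z}$, (i) holds with $\bar{\bar d}_{Z,2}$, and, if some $F\in\mathcal E$ has at least two elements, (ii) holds with $\bar{\bar d}_{Z,1}$. -/

import Mathlib

open Set Filter Topology
open scoped ENNReal

noncomputable section

/-! ## Geodesics, curvature bounds and averages in (pseudo)metric spaces -/

namespace MetricGeometry

section

variable {Y : Type*} [PseudoMetricSpace Y]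

/-- `γ`, restricted to `[0, dist a b]`, is a geodesic from `a` to `b`, parametrized by arc length. -/
def IsGeodesic (γ : ℝ → Y) (a b : Y) : Prop :=
  γ 0 = a ∧ γ (dist a b) = b ∧
    ∀ s ∈ Icc 0 (dist a b), ∀ t ∈ Icc 0 (dist a b), dist (γ s) (γ t) = |s - t|

/-- Geodesics are unique in some neighbourhood `U` of `p`: any two geodesics that run inside `U`
and have the same end points coincide. (Two points at distance `0` count as the same point.) -/
def GeodesicsLocallyUniqueAt (p : Y) : Prop :=
  ∃ U ∈ 𝓝 p, ∀ a b : Y, ∀ γ γ' : ℝ → Y, IsGeodesic γ a b → IsGeodesic γ' a b →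
    (∀ t ∈ Icc 0 (dist a b), γ t ∈ U) → (∀ t ∈ Icc 0 (dist a b), γ' t ∈ U) →
      ∀ t ∈ Icc 0 (dist a b), dist (γ t) (γ' t) = 0

variable (Y)

/-- Any two points at distance less than `D` are joined by a geodesic. -/
def IsGeodesicBelow (D : EReal) : Prop :=
  ∀ a b : Y, (dist a b : EReal) < D → ∃ γ : ℝ → Y, IsGeodesic γ a b

/-- Geodesic triangles of perimeter less than `2 * D` are not thicker than their comparison
triangles in the model plane `M` with distance `δ`: a point `γ t` of the side `bc` is not
farther from the opposite vertex `a` than the comparison point `x'` is from `a'`. -/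
def TrianglesAreThin (D : EReal) {M : Type} (δ : M → M → ℝ) : Prop :=
  ∀ (a b c : Y) (γ : ℝ → Y), IsGeodesic γ b c →
    (((dist a b + dist b c + dist c a) / 2 : ℝ) : EReal) < D →
    ∀ a' b' c' : M, δ a' b' = dist a b → δ b' c' = dist b c → δ c' a' = dist c a →
    ∀ t ∈ Icc 0 (dist b c), ∀ x' : M, δ b' x' = t → δ x' c' = dist b c - t →
      dist (γ t) a ≤ δ x' a'

/-- `CAT(κ)` spaces. The model planes are the hyperbolic plane with its distance divided by
`√(-κ)`, the Euclidean plane, and the unit sphere with its angular distance divided by `√κ`. -/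
def IsCAT (κ : ℝ) : Prop :=
  (κ < 0 → IsGeodesicBelow Y ⊤ ∧
    TrianglesAreThin Y ⊤ (fun u v : UpperHalfPlane => dist u v / √(-κ))) ∧
  (κ = 0 → IsGeodesicBelow Y ⊤ ∧
    TrianglesAreThin Y ⊤ (fun u v : EuclideanSpace ℝ (Fin 2) => dist u v)) ∧
  (0 < κ → IsGeodesicBelow Y ((Real.pi / √κ : ℝ) : EReal) ∧
    TrianglesAreThin Y ((Real.pi / √κ : ℝ) : EReal)
      (fun u v : Metric.sphere (0 : EuclideanSpace ℝ (Fin 3)) 1 =>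
        InnerProductGeometry.angle (u : EuclideanSpace ℝ (Fin 3)) v / √κ))

variable {Y}

/-- The curvature at `p` is bounded above by `κ`: some ball around `p` is a `CAT(κ)` space. -/
def CurvatureLEAt (κ : ℝ) (p : Y) : Prop :=
  ∃ r > 0, IsCAT (Metric.ball p r) κ

/-- The curvature at `p` is not bounded above by any real number. -/
def CurvatureUnboundedAt (p : Y) : Prop :=
  ∀ κ : ℝ, ¬ CurvatureLEAt κ p

variable (Y) in
/-- Non-positive curvature is a generic property: it holds on an open dense subset. -/
def GenericallyNonpositivelyCurved : Prop :=
  ∃ G : Set Y, IsOpen G ∧ Dense G ∧ ∀ p ∈ G, CurvatureLEAt 0 p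

/-- `c` is a Fréchet mean of the data `s`: a minimizer of the sum of squared distances. -/
def IsFrechetMean (n : ℕ) (s : Fin n → Y) (c : Y) : Prop :=
  ∀ y : Y, ∑ i, dist c (s i) ^ 2 ≤ ∑ i, dist y (s i) ^ 2

/-- `c` is a Karcher mean of the data `s`: a local minimizer of the sum of squared distances. -/
def IsKarcherMean (n : ℕ) (s : Fin n → Y) (c : Y) : Prop :=
  IsLocalMin (fun y : Y => ∑ i, dist y (s i) ^ 2) c

/-- `c` is a circumcenter of the data `s`: the center of a smallest closed ball containing them. -/
def IsCircumcenter (n : ℕ) (s : Fin n → Y) (c : Y) : Prop :=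
  ∃ r : ℝ, range s ⊆ Metric.closedBall c r ∧
    ∀ (c' : Y) (r' : ℝ), range s ⊆ Metric.closedBall c' r' → r ≤ r'

/-- `c` is a centroid of the data `s`. A centroid of two points is the midpoint of a geodesic
joining them. For more points, each point of the next tuple `C (k + 1)` is a centroid of the tuple
`C k` with one entry omitted, and the points of these tuples converge to `c`. In a uniquely geodesic
space all the choices are forced. -/
def IsCentroid : (n : ℕ) → (Fin n → Y) → Y → Prop
  | 0, _, _ => False
  | 1, s, c => c = s 0
  | 2, s, c => ∃ γ : ℝ → Y, IsGeodesic γ (s 0) (s 1) ∧ c = γ (dist (s 0) (s 1) / 2)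
  | (n + 3), s, c => ∃ C : ℕ → Fin (n + 3) → Y, C 0 = s ∧
      (∀ k i, IsCentroid (n + 2) (fun j => C k (i.succAbove j)) (C (k + 1) i)) ∧
      ∀ i, Tendsto (fun k => C k i) atTop (𝓝 c)

/-- Averages in the sense of `avg` are unique in some neighbourhood `U` of `p`: a non-empty finite
dataset in `U` has at most one average in `U` (up to distance `0`). -/
def AveragesLocallyUniqueAt (avg : (n : ℕ) → (Fin n → Y) → Y → Prop) (p : Y) : Prop :=
  ∃ U ∈ 𝓝 p, ∀ n : ℕ, 1 ≤ n → ∀ s : Fin n → Y, (∀ i, s i ∈ U) →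
    ∀ c ∈ U, ∀ c' ∈ U, avg n s c → avg n s c' → dist c c' = 0

variable (Y) in
/-- Everywhere unbounded curvature, and nowhere locally unique geodesics, means (Fréchet and
Karcher), circumcenters and centroids. -/
def EverywhereIllPosed : Prop :=
  ∀ p : Y, CurvatureUnboundedAt p ∧
    ¬ GeodesicsLocallyUniqueAt p ∧
    ¬ AveragesLocallyUniqueAt IsFrechetMean p ∧
    ¬ AveragesLocallyUniqueAt IsKarcherMean p ∧
    ¬ AveragesLocallyUniqueAt IsCircumcenter p ∧
    ¬ AveragesLocallyUniqueAt IsCentroid p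

end

end MetricGeometry

/-! ## Tree-shape spaces -/

namespace TreeShape

/-- A finite rooted ordered binary tree. Vertices are words in the letters `false` (left child) and
`true` (right child), the root is the empty word, and the edge that ends in the vertex `w ≠ []` is
identified with `w`. -/
structure BinaryTree where
  edges : Finset (List Bool)
  nil_notMem : [] ∉ edges
  parent_mem : ∀ (w : List Bool) (b : Bool), w ≠ [] → w ++ [b] ∈ edges → w ∈ edges

/-- The edge set `E` of the tree. -/
abbrev BinaryTree.Edge (T : BinaryTree) : Type := {w : List Bool // w ∈ T.edges}

/-- The attribute space `A = (ℝ^d)^n` with its Euclidean norm. -/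
abbrev Attr (d n : ℕ) : Type := PiLp 2 (fun _ : Fin n => EuclideanSpace ℝ (Fin d))

/-- The pre-shape space `X = ∏_{e ∈ E} A`. For `p = 1` its distance is `∑ ‖x_e - y_e‖`, for `p = 2`
it is `√(∑ ‖x_e - y_e‖ ^ 2)`. -/
abbrev PreShape (T : BinaryTree) (d n : ℕ) (p : ℝ≥0∞) : Type :=
  PiLp p (fun _ : T.Edge => Attr d n)

variable {T : BinaryTree} {d n : ℕ} {p : ℝ≥0∞}

/-- The edges of a pre-shape that are not collapsed. -/
def PreShape.supp (x : PreShape T d n p) : Set T.Edge := {e | x e ≠ 0}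

/-- `φ : F ≃ F'` is an isomorphism between the ordered trees obtained from `T` by collapsing all
edges outside `F`, respectively `F'`: it preserves the ancestor relation (prefixes) and the
depth-first order (the lexicographic order of words). -/
def IsOrderedIso {F F' : Set T.Edge} (φ : F ≃ F') : Prop :=
  (∀ e f : F, e.1.1 <+: f.1.1 ↔ (φ e).1.1 <+: (φ f).1.1) ∧
  (∀ e f : F, e.1.1 < f.1.1 ↔ (φ e).1.1 < (φ f).1.1)

/-- `x ∼ y`: the collapsed ordered attributed trees represented by `x` and `y` are identical. -/
def SameOrderedShape (x y : PreShape T d n p) : Prop :=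
  ∃ φ : x.supp ≃ y.supp, IsOrderedIso φ ∧ ∀ e : x.supp, y (φ e).1 = x e.1

/-- The group `G` of reorderings of `T`: the automorphisms of `T` as a rooted (unordered) tree. -/
def reorderings (T : BinaryTree) : Subgroup (Equiv.Perm T.Edge) where
  carrier := {g | ∀ e f : T.Edge, e.1 <+: f.1 ↔ (g e).1 <+: (g f).1}
  one_mem' := fun _ _ => Iff.rfl
  mul_mem' := fun {g h} hg hh e f => (hh e f).trans (hg (h e) (h f))
  inv_mem' := fun {g} hg e f => by
    have h := hg (g⁻¹ e) (g⁻¹ f)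
    have h1 : ∀ u, g (g⁻¹ u) = u := fun u => g.apply_symm_apply u
    rw [h1, h1] at h
    exact h.symm

/-- `y` is obtained from `x` by a reordering of `T`. -/
def IsReorderingOf (x y : PreShape T d n p) : Prop :=
  ∃ g ∈ reorderings T, ∀ e, y (g e) = x e

/-- The equivalence relation on `X` whose quotient is `(X / ∼) / G`. -/
def unorderedSetoid (T : BinaryTree) (d n : ℕ) (p : ℝ≥0∞) : Setoid (PreShape T d n p) :=
  Relation.EqvGen.setoid (fun x y => SameOrderedShape x y ∨ IsReorderingOf x y)

/-- A set of tree topologies, given by the sets of edges of `T` that are not collapsed; it contains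
with one representation of an ordered tree topology all other representations of this topology. -/
structure Topologies (T : BinaryTree) where
  sets : Set (Set T.Edge)
  closed : ∀ F ∈ sets, ∀ (F' : Set T.Edge) (φ : F ≃ F'), IsOrderedIso φ → F' ∈ sets

/-- The choice without any restriction: no edge of `T` has to be collapsed. -/
def Topologies.full (T : BinaryTree) : Topologies T where
  sets := {univ}
  closed := by
    rintro F rfl F' φ -
    have h : Nat.card F' = Nat.card T.Edge :=
      Nat.card_congr (φ.symm.trans (Equiv.Set.univ T.Edge))
    exact (Set.eq_univ_iff_ncard F').2 h

/-- The restricted pre-shape space `Z = ⋃ Z_i`, as a subset of `X`. -/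
def preShapes (Θ : Topologies T) (d n : ℕ) (p : ℝ≥0∞) : Set (PreShape T d n p) :=
  {x | ∃ F ∈ Θ.sets, x.supp ⊆ F}

/-- The two metrics that a metric on `X` induces on a subset `Z`: the restricted metric, and the
length metric (for a finite union of linear subspaces, the infimum of the lengths of broken lines
in `Z`). -/
inductive InducedMetric
  | restricted
  | length

/-- The straight lines that may be used in `Z`: from any point to any other one for the restricted
metric, only those that run inside `Z` for the length metric. -/
def IsLeg : InducedMetric → (Z : Set (PreShape T d n p)) → PreShape T d n p → PreShape T d n p → Prop
  | .restricted, _, _, _ => True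
  | .length, Z, x, y => segment ℝ x y ⊆ Z

/-- The space of unordered tree-shapes with topologies in `Θ`: the image of `Z` in `(X / ∼) / G`.
The metric on it depends on the label `_m`. -/
def UnorderedSpace (T : BinaryTree) (Θ : Topologies T) (_m : InducedMetric) (d n : ℕ) (p : ℝ≥0∞) :
    Type :=
  Quotient ((unorderedSetoid T d n p).comap
    (Subtype.val : preShapes Θ d n p → PreShape T d n p))

variable {Θ : Topologies T} {m : InducedMetric}

/-- The tree-shape represented by a pre-shape. -/
def UnorderedSpace.mk (m : InducedMetric) (x : preShapes Θ d n p) : UnorderedSpace T Θ m d n p :=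
  Quotient.mk _ x

/-- `IsChain a b L`: there are `x_1, y_1, …, x_k, y_k` in `Z` with `x_1` representing `a`, `y_k`
representing `b`, `y_i` equivalent to `x_{i+1}`, and `L = ∑ d(x_i, y_i)`, all the lines from
`x_i` to `y_i` being admissible. -/
inductive IsChain [Fact (1 ≤ p)] :
    UnorderedSpace T Θ m d n p → UnorderedSpace T Θ m d n p → ℝ → Prop
  | refl (a : UnorderedSpace T Θ m d n p) : IsChain a a 0
  | cons (x y : preShapes Θ d n p) (b : UnorderedSpace T Θ m d n p) (L : ℝ) :
      IsLeg m (preShapes Θ d n p) x.1 y.1 → IsChain (UnorderedSpace.mk m y) b L →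
      IsChain (UnorderedSpace.mk m x) b (dist x.1 y.1 + L)

theorem IsLeg.symm {Z : Set (PreShape T d n p)} {x y : PreShape T d n p} (h : IsLeg m Z x y) :
    IsLeg m Z y x := by
  cases m with
  | restricted => trivial
  | length => exact (segment_symm ℝ y x).trans_subset h

section

variable [Fact (1 ≤ p)] {a b c : UnorderedSpace T Θ m d n p} {L L' : ℝ}

theorem IsChain.nonneg (h : IsChain a b L) : 0 ≤ L := by
  induction h with
  | refl a => exact le_rfl
  | cons x y b L _ _ ih => exact add_nonneg dist_nonneg ih

theorem IsChain.append (h : IsChain a b L) (h' : IsChain b c L') : IsChain a c (L + L') := by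
  induction h with
  | refl a => simpa using h'
  | cons x y b L hl _ ih =>
    rw [add_assoc]
    exact .cons x y _ _ hl (ih h')

theorem IsChain.symm (h : IsChain a b L) : IsChain b a L := by
  induction h with
  | refl a => exact .refl a
  | cons x y b L hl _ ih =>
    have h1 : IsChain (UnorderedSpace.mk m y) (UnorderedSpace.mk m x) (dist y.1 x.1 + 0) :=
      .cons y x _ _ hl.symm (.refl _)
    have h2 := ih.append h1
    rwa [add_zero, dist_comm, add_comm] at h2

theorem IsChain.to_zero (F : Set T.Edge) (hF : F ∈ Θ.sets) (a : UnorderedSpace T Θ m d n p) :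
    ∃ L, IsChain a
      (UnorderedSpace.mk m ⟨0, F, hF, fun _ he => absurd rfl he⟩) L := by
  induction a using Quotient.inductionOn with
  | h x =>
    refine ⟨_, .cons x _ _ _ ?_ (.refl _)⟩
    cases m with
    | restricted => trivial
    | length =>
      obtain ⟨F', hF', hx⟩ := x.2
      rintro z ⟨s, t, -, -, -, rfl⟩
      refine ⟨F', hF', fun e he => hx fun h0 => he ?_⟩
      simp [h0]

theorem IsChain.exists_chain (a b : UnorderedSpace T Θ m d n p) : ∃ L, IsChain a b L := by
  obtain ⟨F, hF, -⟩ : ∃ F ∈ Θ.sets, True := by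
    induction a using Quotient.inductionOn with
    | h x => exact ⟨x.2.choose, x.2.choose_spec.1, trivial⟩
  obtain ⟨L, hL⟩ := IsChain.to_zero F hF a
  obtain ⟨L', hL'⟩ := IsChain.to_zero F hF b
  exact ⟨_, hL.append hL'.symm⟩

end

/-- The quotient (pseudo)metric: the infimum of the lengths of all chains. -/
instance [Fact (1 ≤ p)] : PseudoMetricSpace (UnorderedSpace T Θ m d n p) where
  dist a b := sInf {L | IsChain a b L}
  dist_self a := le_antisymm
    (csInf_le ⟨0, fun _ h => IsChain.nonneg h⟩ (IsChain.refl a))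
    (le_csInf ⟨0, IsChain.refl a⟩ fun _ h => IsChain.nonneg h)
  dist_comm a b := congrArg sInf (Set.ext fun _ => ⟨IsChain.symm, IsChain.symm⟩)
  dist_triangle a b c := by
    have hbdd : ∀ u v : UnorderedSpace T Θ m d n p, BddBelow {L | IsChain u v L} :=
      fun u v => ⟨0, fun _ h => IsChain.nonneg h⟩
    refine le_of_forall_pos_lt_add fun ε hε => ?_
    obtain ⟨L, hL, hLε⟩ := Real.lt_sInf_add_pos (IsChain.exists_chain a b) (half_pos hε)
    obtain ⟨L', hL', hLε'⟩ := Real.lt_sInf_add_pos (IsChain.exists_chain b c) (half_pos hε)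
    have h := csInf_le (hbdd a c) (hL.append hL')
    change sInf {L | IsChain a c L} < sInf {L | IsChain a b L} + sInf {L | IsChain b c L} + ε
    change L < sInf {L | IsChain a b L} + ε / 2 at hLε
    change L' < sInf {L | IsChain b c L} + ε / 2 at hLε'
    linarith

/-- The space of all unordered tree-shapes spanned by `T`, `(X / ∼) / G`. -/
abbrev FullUnorderedSpace (T : BinaryTree) (d n : ℕ) (p : ℝ≥0∞) : Type :=
  UnorderedSpace T (Topologies.full T) .restricted d n p

end TreeShape

end

/-! Near suitable pre-shapes `x` the quotient is isometric to a small ball in the coordinate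
subspace spanned by the edges of `x`, and the centers of these charts are dense
(`exists_hasChartAt_near`). With `p = 2` such a ball is a convex Euclidean set, hence `CAT(0)`. With
`p = 1` and at least two edges it contains `ℓ¹` squares. The two monotone paths around a square are
geodesics whose midpoints are far apart, which refutes every curvature bound, unique geodesics and
all four averages, already for two data points. Since ill-posedness only needs squares arbitrarily
close to a point, generic charts give it at every point.

A suitable `x` has as many edges as possible among pre-shapes close to the given point, and pairwise
different attributes. Equivalent pre-shapes differ by a permutation of coordinates, an isometry that
respects equivalence on all further collapsed pre-shapes (`exists_reindex_of_equiv`). The jumps of a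
short chain can therefore be undone one after the other: no edge of `x` can vanish over a short
distance, and by maximality none can appear, so the chain becomes a path in the coordinate subspace
(`IsChain.exists_lift`). Its end point is determined up to a permutation, which the different
attributes force to be trivial on the edges of `x`. Hence short chains are no shortcuts.

Lifting does not ask which legs are admissible, and segments in a coordinate subspace of `Z` always
are. So the restricted and the length metric are handled together. -/

namespace MetricGeometry

/-! ### Convex subsets of inner product spaces are `CAT(0)` -/

section Flat

variable {V : Type*} [NormedAddCommGroup V] [InnerProductSpace ℝ V]

/-- A point that divides a segment at distance `t` from one end is determined by its distances. -/
theorem eq_lineMap_of_dist {b c x : V} {t L : ℝ} (hL : dist b c = L) (hL0 : 0 < L)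
    (h1 : dist b x = t) (h2 : dist x c = L - t) : x = AffineMap.lineMap b c (t / L) := by
  refine eq_lineMap_of_dist_eq_mul_of_dist_eq_mul ?_ ?_
  · rw [h1, hL]; field_simp
  · rw [h2, hL]; field_simp

/-- Stewart's theorem in an inner product space. -/
theorem dist_sq_eq_of_dist {b c x : V} (a : V) {t L : ℝ} (hL : dist b c = L) (hL0 : 0 < L)
    (h1 : dist b x = t) (h2 : dist x c = L - t) :
    dist x a ^ 2 = (1 - t / L) * dist a b ^ 2 + t / L * dist c a ^ 2 - t * (L - t) := by
  have hx := eq_lineMap_of_dist hL hL0 h1 h2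
  obtain ⟨s, hs⟩ : ∃ s, s = t / L := ⟨_, rfl⟩
  have ht : t = s * L := by rw [hs]; field_simp
  rw [← hs] at hx ⊢
  have e1 : x - a = (1 - s) • (b - a) + s • (c - a) := by
    rw [hx, AffineMap.lineMap_apply_module]
    module
  have e2 : b - c = (b - a) - (c - a) := by abel
  have n1 : L ^ 2 = ‖b - a‖ ^ 2 - 2 * inner ℝ (b - a) (c - a) + ‖c - a‖ ^ 2 := by
    rw [← hL, dist_eq_norm, e2, norm_sub_sq_real]
  rw [dist_eq_norm x a, e1, norm_add_sq_real, norm_smul, norm_smul, inner_smul_left,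
    inner_smul_right, dist_comm a b, dist_eq_norm b a, dist_eq_norm c a, mul_pow, mul_pow,
    Real.norm_eq_abs, Real.norm_eq_abs, sq_abs, sq_abs, ht]
  simp only [conj_trivial]
  linear_combination (s * (1 - s)) * n1

/-- A space isometric to a convex subset of an inner product space is `CAT(0)`. -/
theorem isCAT_zero_of_isometry {Y : Type*} [PseudoMetricSpace Y] {f : Y → V} (hf : Isometry f)
    (hinj : Function.Injective f) (hc : Convex ℝ (range f)) : IsCAT Y 0 := by
  refine ⟨fun h => absurd h (lt_irrefl _), fun _ => ⟨?_, ?_⟩, fun h => absurd h (lt_irrefl _)⟩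
  · intro a b _
    rcases eq_or_lt_of_le (dist_nonneg (x := a) (y := b)) with h0 | h0
    -- `Y` is only pseudometric, so an isometry need not be injective; without `hinj` points at
    -- distance `0` might differ, and then no geodesic could join them.
    · obtain rfl : a = b := hinj (dist_eq_zero.1 ((hf.dist_eq a b).trans h0.symm))
      refine ⟨fun _ => a, rfl, rfl, fun s hs t ht => ?_⟩
      rw [← h0, Icc_self, mem_singleton_iff] at hs ht
      simp [hs, ht]
    · have key : ∀ t : ℝ, ∃ y : Y, t ∈ Icc 0 (dist a b) →
          f y = AffineMap.lineMap (f a) (f b) (t / dist a b) := by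
        intro t
        by_cases ht : t ∈ Icc 0 (dist a b)
        · obtain ⟨y, hy⟩ := hc.lineMap_mem (mem_range_self a) (mem_range_self b)
            (t := t / dist a b) ⟨div_nonneg ht.1 h0.le, (div_le_one h0).2 ht.2⟩
          exact ⟨y, fun _ => hy⟩
        · exact ⟨a, fun h => absurd h ht⟩
      choose g hg using key
      refine ⟨g, hinj ?_, hinj ?_, fun s hs t ht => ?_⟩
      · rw [hg 0 ⟨le_rfl, h0.le⟩, zero_div, AffineMap.lineMap_apply_zero]
      · rw [hg _ ⟨h0.le, le_rfl⟩, div_self h0.ne', AffineMap.lineMap_apply_one]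
      · rw [← hf.dist_eq, hg s hs, hg t ht, dist_lineMap_lineMap, hf.dist_eq, Real.dist_eq,
          ← sub_div, abs_div, abs_of_pos h0, div_mul_cancel₀ _ h0.ne']
  · intro a b c γ hγ _ a' b' c' hab hbc hca t ht x' hbx hxc
    have h1 : dist (f b) (f (γ t)) = t := by
      rw [hf.dist_eq, ← hγ.1, hγ.2.2 0 ⟨le_rfl, dist_nonneg⟩ t ht, zero_sub, abs_neg,
        abs_of_nonneg ht.1]
    have h2 : dist (f (γ t)) (f c) = dist b c - t := by
      have := hγ.2.2 t ht _ ⟨dist_nonneg, le_rfl⟩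
      rwa [hγ.2.1, abs_sub_comm, abs_of_nonneg (sub_nonneg.2 ht.2), ← hf.dist_eq] at this
    rcases eq_or_lt_of_le (dist_nonneg (x := b) (y := c)) with h0 | h0
    · have ht0 : t = 0 := le_antisymm (ht.2.trans_eq h0.symm) ht.1
      have e1 : f b = f (γ t) := dist_eq_zero.1 (h1.trans ht0)
      have e2 : b' = x' := dist_eq_zero.1 (hbx.trans ht0)
      rw [← hf.dist_eq, ← e1, hf.dist_eq, ← e2, dist_comm b a]
      exact hab.symm.le.trans (dist_comm a' b').le
    -- Stewart's formula expresses both distances by the same side lengths, so the comparison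
    -- inequality is an equality.
    · have e1 := dist_sq_eq_of_dist (f a) (hf.dist_eq b c) h0 h1 h2
      have e2 := dist_sq_eq_of_dist a' hbc h0 hbx hxc
      simp only [hf.dist_eq] at e1
      simp only at hab hca
      rw [hab, hca, ← e1] at e2
      exact (pow_le_pow_iff_left₀ dist_nonneg dist_nonneg two_ne_zero).1 e2.ge

end Flat

/-! ### Small `ℓ¹` squares destroy curvature bounds and unique averages -/

section Taxicab

variable {Y : Type*} [PseudoMetricSpace Y]

/-- `f` embeds the square `[0, δ] × [0, δ]` with the `ℓ¹` metric isometrically. -/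
def IsTaxicabSquare (δ : ℝ) (f : ℝ → ℝ → Y) : Prop :=
  ∀ s ∈ Icc 0 δ, ∀ t ∈ Icc 0 δ, ∀ s' ∈ Icc 0 δ, ∀ t' ∈ Icc 0 δ,
    dist (f s t) (f s' t') = |s - s'| + |t - t'|

/-- Every neighbourhood of `p` contains arbitrarily small taxicab squares. -/
def HasTaxicabSquaresAt (p : Y) : Prop :=
  ∀ ε > 0, ∃ δ > 0, δ < ε ∧ ∃ f : ℝ → ℝ → Y, IsTaxicabSquare δ f ∧
    ∀ s ∈ Icc 0 δ, ∀ t ∈ Icc 0 δ, dist (f s t) p < ε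

/-- The path in a square that first follows the first coordinate, then the second one. -/
def cornerPath (δ : ℝ) (f : ℝ → ℝ → Y) (t : ℝ) : Y :=
  f (max 0 (min t δ)) (max 0 (min (t - δ) δ))

variable {δ : ℝ} {f : ℝ → ℝ → Y}

theorem clamp_mem (hδ : 0 < δ) (t : ℝ) : max 0 (min t δ) ∈ Icc 0 δ :=
  ⟨le_max_left _ _, max_le hδ.le (min_le_right _ _)⟩

theorem IsTaxicabSquare.swap (hf : IsTaxicabSquare δ f) :
    IsTaxicabSquare δ (fun s t => f t s) := fun s hs t ht s' hs' t' ht' => by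
  rw [hf t ht s hs t' ht' s' hs', add_comm]

theorem IsTaxicabSquare.dist_diagonal (hf : IsTaxicabSquare δ f) (hδ : 0 < δ) :
    dist (f 0 0) (f δ δ) = 2 * δ := by
  have h0 : (0 : ℝ) ∈ Icc 0 δ := ⟨le_rfl, hδ.le⟩
  have h1 : δ ∈ Icc 0 δ := ⟨hδ.le, le_rfl⟩
  rw [hf 0 h0 0 h0 δ h1 δ h1, zero_sub, abs_neg, abs_of_pos hδ, two_mul]

theorem cornerPath_mid {Z : Type*} {g : ℝ → ℝ → Z} (hδ : 0 < δ) : cornerPath δ g δ = g δ 0 := by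
  simp [cornerPath, hδ.le]

/-- Paths that are monotone in both coordinates are shortest in `ℓ¹`: only one coordinate moves on
each half, and the two increments add up. -/
theorem IsTaxicabSquare.isGeodesic_cornerPath (hf : IsTaxicabSquare δ f) (hδ : 0 < δ) :
    IsGeodesic (cornerPath δ f) (f 0 0) (f δ δ) := by
  rw [IsGeodesic, hf.dist_diagonal hδ]
  refine ⟨?_, ?_, fun s hs t ht => ?_⟩
  · simp [cornerPath, hδ.le]
  · have : 2 * δ - δ = δ := by ring
    rw [cornerPath, this, min_self, min_eq_right (by linarith), max_eq_right hδ.le]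
  · rw [cornerPath, cornerPath, hf _ (clamp_mem hδ _) _ (clamp_mem hδ _) _ (clamp_mem hδ _) _
      (clamp_mem hδ _)]
    obtain ⟨hs0, hs1⟩ := hs
    obtain ⟨ht0, ht1⟩ := ht
    rcases le_total s δ with h1 | h1 <;> rcases le_total t δ with h2 | h2
    · rw [min_eq_left h1, min_eq_left h2, max_eq_right hs0, max_eq_right ht0,
        min_eq_left (by linarith), min_eq_left (by linarith), max_eq_left (by linarith),
        max_eq_left (by linarith), sub_self, abs_zero, add_zero]
    · rw [min_eq_left h1, min_eq_right h2, max_eq_right hs0, max_eq_right hδ.le,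
        min_eq_left (by linarith), min_eq_left (by linarith), max_eq_left (by linarith),
        max_eq_right (by linarith), abs_of_nonpos (by linarith), abs_of_nonpos (by linarith),
        abs_of_nonpos (by linarith)]
      ring
    · rw [min_eq_right h1, min_eq_left h2, max_eq_right ht0, max_eq_right hδ.le,
        min_eq_left (by linarith), min_eq_left (by linarith), max_eq_right (by linarith),
        max_eq_left (by linarith), abs_of_nonneg (by linarith), abs_of_nonneg (by linarith),
        abs_of_nonneg (by linarith)]
      ring
    · rw [min_eq_right h1, min_eq_right h2, max_eq_right hδ.le,
        min_eq_left (by linarith), min_eq_left (by linarith), max_eq_right (by linarith),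
        max_eq_right (by linarith), sub_self, abs_zero, zero_add]
      congr 1
      ring

theorem IsTaxicabSquare.dist_corners (hf : IsTaxicabSquare δ f) (hδ : 0 < δ) :
    dist (f δ 0) (f 0 δ) = 2 * δ := by
  have h0 : (0 : ℝ) ∈ Icc 0 δ := ⟨le_rfl, hδ.le⟩
  have h1 : δ ∈ Icc 0 δ := ⟨hδ.le, le_rfl⟩
  rw [hf δ h1 0 h0 0 h0 δ h1, zero_sub, sub_zero, abs_neg, abs_of_pos hδ, two_mul]

/-- Thin triangles exclude small squares if the model plane contains a segment with midpoint. -/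
theorem IsTaxicabSquare.not_trianglesAreThin (hf : IsTaxicabSquare δ f) (hδ : 0 < δ) {D : EReal}
    (hD : ((2 * δ : ℝ) : EReal) < D) {M : Type} {d : M → M → ℝ} {b x c : M}
    (hbc : d b c = 2 * δ) (hbx : d b x = δ) (hxb : d x b = δ) (hxc : d x c = δ) (hcx : d c x = δ)
    (hxx : d x x = 0) : ¬ TrianglesAreThin Y D d := by
  intro h
  have h0 : (0 : ℝ) ∈ Icc 0 δ := ⟨le_rfl, hδ.le⟩
  have h1 : δ ∈ Icc 0 δ := ⟨hδ.le, le_rfl⟩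
  have e1 : dist (f 0 δ) (f 0 0) = δ := by
    rw [hf 0 h0 δ h1 0 h0 0 h0]; simp [abs_of_pos hδ]
  have e2 : dist (f δ δ) (f 0 δ) = δ := by
    rw [hf δ h1 δ h1 0 h0 δ h1]; simp [abs_of_pos hδ]
  have e3 := hf.dist_diagonal hδ
  -- The triangle has sides `δ`, `2 * δ`, `δ`, so its comparison triangle is degenerate, with the
  -- vertex `a'` at the midpoint `x` of the long side. But the long side may run through the corner
  -- opposite to `f 0 δ`, whose distance from it is `2 * δ` instead of `0`.
  have := h (f 0 δ) (f 0 0) (f δ δ) _ (hf.isGeodesic_cornerPath hδ)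
    (by rw [e1, e2, e3]; convert hD using 2; ring) x b c (hxb.trans e1.symm) (hbc.trans e3.symm)
    (hcx.trans e2.symm) δ ⟨hδ.le, by linarith⟩ x hbx (by rw [hxc, e3]; ring)
  rw [cornerPath_mid hδ, hf.dist_corners hδ, hxx] at this
  linarith

/-- Each model plane contains a geodesic segment of length `2 * δ`, which is all that the degenerate
comparison triangle needs. Only on the sphere does this restrict `δ`. -/
theorem IsTaxicabSquare.not_isCAT (hf : IsTaxicabSquare δ f) (hδ : 0 < δ) {κ : ℝ}
    (hκ : 0 < κ → 2 * δ < Real.pi / √κ) : ¬ IsCAT Y κ := by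
  intro h
  rcases lt_trichotomy κ 0 with h0 | h0 | h0
  · have hk : 0 < √(-κ) := Real.sqrt_pos.2 (neg_pos.2 h0)
    -- The imaginary half-axis is a hyperbolic line, with arc length the logarithm of the height.
    obtain ⟨q, hq⟩ : ∃ q : ℝ → UpperHalfPlane, ∀ s t, dist (q s) (q t) / √(-κ) = |s - t| := by
      refine ⟨fun s => ⟨⟨0, Real.exp (√(-κ) * s)⟩, Real.exp_pos _⟩, fun s t => ?_⟩
      rw [UpperHalfPlane.dist_of_re_eq (by rfl)]
      change dist (Real.log (Real.exp _)) (Real.log (Real.exp _)) / _ = _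
      rw [Real.log_exp, Real.log_exp, Real.dist_eq, ← mul_sub, abs_mul, abs_of_pos hk,
        mul_div_cancel_left₀ _ hk.ne']
    refine hf.not_trianglesAreThin hδ (EReal.coe_lt_top _) (b := q 0) (x := q δ) (c := q (2 * δ))
      ?_ ?_ ?_ ?_ ?_ ?_ (h.1 h0).2 <;> rw [hq]
    · rw [zero_sub, abs_neg, abs_of_pos (by linarith)]
    · rw [zero_sub, abs_neg, abs_of_pos hδ]
    · rw [sub_zero, abs_of_pos hδ]
    · rw [abs_of_neg (by linarith)]; ring
    · rw [abs_of_pos (by linarith)]; ring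
    · rw [sub_self, abs_zero]
  · obtain ⟨q, hq⟩ : ∃ q : ℝ → EuclideanSpace ℝ (Fin 2), ∀ s t, dist (q s) (q t) = |s - t| :=
      ⟨fun s => PiLp.single 2 0 s, fun s t => by
        rw [PiLp.dist_single_same, Real.dist_eq]⟩
    refine hf.not_trianglesAreThin hδ (EReal.coe_lt_top _) (b := q 0) (x := q δ) (c := q (2 * δ))
      ?_ ?_ ?_ ?_ ?_ ?_ (h.2.1 h0).2 <;> simp only [hq]
    · rw [zero_sub, abs_neg, abs_of_pos (by linarith)]
    · rw [zero_sub, abs_neg, abs_of_pos hδ]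
    · rw [sub_zero, abs_of_pos hδ]
    · rw [abs_of_neg (by linarith)]; ring
    · rw [abs_of_pos (by linarith)]; ring
    · rw [sub_self, abs_zero]
  · have hk : 0 < √κ := Real.sqrt_pos.2 h0
    have hD := hκ h0
    -- An arc of a great circle: angles agree with arc length only up to `π`.
    obtain ⟨q, hq⟩ : ∃ q : ℝ → Metric.sphere (0 : EuclideanSpace ℝ (Fin 3)) 1,
        ∀ s t, |s - t| ≤ 2 * δ → InnerProductGeometry.angle
          (q s : EuclideanSpace ℝ (Fin 3)) (q t) / √κ = |s - t| := by
      have hn : ∀ θ : ℝ, ‖!₂[Real.cos θ, Real.sin θ, 0]‖ = 1 := fun θ => by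
        rw [EuclideanSpace.norm_eq]
        simp [Fin.sum_univ_three]
      refine ⟨fun s => ⟨!₂[Real.cos (√κ * s), Real.sin (√κ * s), 0], by simpa using hn _⟩,
        fun s t hst => ?_⟩
      have hle : √κ * |s - t| ≤ Real.pi := by
        rw [lt_div_iff₀ hk] at hD
        nlinarith
      rw [InnerProductGeometry.angle, hn, hn]
      have : inner ℝ !₂[Real.cos (√κ * s), Real.sin (√κ * s), 0]
          !₂[Real.cos (√κ * t), Real.sin (√κ * t), 0] = Real.cos (√κ * |s - t|) := by
        rw [← abs_of_pos hk, ← abs_mul, Real.cos_abs, abs_of_pos hk, mul_sub, Real.cos_sub]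
        simp [PiLp.inner_apply, Fin.sum_univ_three]
        ring
      rw [this, mul_one, div_one, Real.arccos_cos (by positivity) hle, mul_div_cancel_left₀ _ hk.ne']
    refine hf.not_trianglesAreThin hδ (EReal.coe_lt_coe_iff.2 hD) (b := q 0) (x := q δ)
      (c := q (2 * δ)) ?_ ?_ ?_ ?_ ?_ ?_ (h.2.2 h0).2 <;> rw [hq]
    · rw [zero_sub, abs_neg, abs_of_pos (by linarith)]
    · rw [zero_sub, abs_neg, abs_of_pos (by linarith)]
    · rw [zero_sub, abs_neg, abs_of_pos hδ]
    · rw [zero_sub, abs_neg, abs_of_pos hδ]; linarith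
    · rw [sub_zero, abs_of_pos hδ]
    · rw [sub_zero, abs_of_pos hδ]; linarith
    · rw [abs_of_neg (by linarith)]; ring
    · rw [abs_of_neg (by linarith)]; linarith
    · rw [abs_of_pos (by linarith)]; ring
    · rw [abs_of_pos (by linarith)]; linarith
    · rw [sub_self, abs_zero]
    · rw [sub_self, abs_zero]; linarith

theorem HasTaxicabSquaresAt.curvatureUnboundedAt {p : Y} (hp : HasTaxicabSquaresAt p) :
    CurvatureUnboundedAt p := by
  rintro κ ⟨r, hr, hcat⟩
  obtain ⟨ε, hε, hεr, hεκ⟩ : ∃ ε > 0, ε ≤ r ∧ (0 < κ → 2 * ε ≤ Real.pi / √κ) := by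
    by_cases hκ : 0 < κ
    · have : 0 < Real.pi / √κ := div_pos Real.pi_pos (Real.sqrt_pos.2 hκ)
      exact ⟨min r (Real.pi / √κ / 2), by positivity, min_le_left _ _, fun _ => by
        linarith [min_le_right r (Real.pi / √κ / 2)]⟩
    · exact ⟨r, hr, le_rfl, fun h => absurd h hκ⟩
  obtain ⟨δ, hδ, hδε, f, hf, hfp⟩ := hp ε hε
  -- The parameters are clamped so that the square, as a function on all of `ℝ × ℝ`, takes values in
  -- the ball.
  have hc : ∀ s t, f (max 0 (min s δ)) (max 0 (min t δ)) ∈ Metric.ball p r := fun s t =>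
    (hfp _ (clamp_mem hδ s) _ (clamp_mem hδ t)).trans_le hεr
  have hsq : IsTaxicabSquare δ (fun s t => (⟨_, hc s t⟩ : Metric.ball p r)) := by
    have hcl : ∀ s ∈ Icc 0 δ, max 0 (min s δ) = s := fun s hs => by
      rw [min_eq_left hs.2, max_eq_right hs.1]
    intro s hs t ht s' hs' t' ht'
    simp only [Subtype.dist_eq, hcl s hs, hcl t ht, hcl s' hs', hcl t' ht']
    exact hf s hs t ht s' hs' t' ht'
  exact hsq.not_isCAT hδ (fun h => by linarith [hεκ h]) hcat

/-- Two points of a square at opposite corners, with the other two corners as midpoints. -/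
theorem HasTaxicabSquaresAt.exists_bigon {p : Y} (hp : HasTaxicabSquaresAt p) {U : Set Y}
    (hU : U ∈ 𝓝 p) : ∃ a ∈ U, ∃ b ∈ U, ∃ γ γ' : ℝ → Y, IsGeodesic γ a b ∧ IsGeodesic γ' a b ∧
      (∀ t, γ t ∈ U) ∧ (∀ t, γ' t ∈ U) ∧
      dist (γ (dist a b / 2)) (γ' (dist a b / 2)) ≠ 0 := by
  obtain ⟨ε, hε, hεU⟩ := Metric.mem_nhds_iff.1 hU
  obtain ⟨δ, hδ, -, f, hf, hfp⟩ := hp ε hε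
  have h0 : (0 : ℝ) ∈ Icc 0 δ := ⟨le_rfl, hδ.le⟩
  have h1 : δ ∈ Icc 0 δ := ⟨hδ.le, le_rfl⟩
  refine ⟨f 0 0, hεU (hfp 0 h0 0 h0), f δ δ, hεU (hfp δ h1 δ h1), cornerPath δ f,
    cornerPath δ (fun s t => f t s), hf.isGeodesic_cornerPath hδ, hf.swap.isGeodesic_cornerPath hδ,
    fun t => hεU (hfp _ (clamp_mem hδ _) _ (clamp_mem hδ _)),
    fun t => hεU (hfp _ (clamp_mem hδ _) _ (clamp_mem hδ _)), ?_⟩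
  rw [hf.dist_diagonal hδ, mul_div_cancel_left₀ _ two_ne_zero, cornerPath_mid hδ,
    cornerPath_mid hδ, hf.dist_corners hδ]
  positivity

theorem IsGeodesic.dist_mid {γ : ℝ → Y} {a b : Y} (h : IsGeodesic γ a b) :
    dist (γ (dist a b / 2)) a = dist a b / 2 ∧ dist (γ (dist a b / 2)) b = dist a b / 2 := by
  have hd : 0 ≤ dist a b := dist_nonneg
  have hm : dist a b / 2 ∈ Icc 0 (dist a b) := ⟨by linarith, by linarith⟩
  have e1 := h.2.2 _ hm 0 ⟨le_rfl, hd⟩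
  have e2 := h.2.2 _ hm _ ⟨hd, le_rfl⟩
  rw [h.1, sub_zero, abs_of_nonneg hm.1] at e1
  rw [h.2.1, abs_of_nonpos (by linarith)] at e2
  exact ⟨e1, by rw [e2]; ring⟩

/-- With `u = dist y a` and `v = dist y b`, the triangle inequality gives `u ^ 2 + v ^ 2 ≥ (u + v) ^
2 / 2 ≥ dist a b ^ 2 / 2`, which the midpoint attains. -/
theorem IsGeodesic.isFrechetMean_mid {γ : ℝ → Y} {a b : Y} (h : IsGeodesic γ a b) :
    IsFrechetMean 2 ![a, b] (γ (dist a b / 2)) := by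
  intro y
  obtain ⟨e1, e2⟩ := h.dist_mid
  simp only [Fin.sum_univ_two, Matrix.cons_val_zero, Matrix.cons_val_one, e1, e2]
  nlinarith [dist_triangle_left a b y, sq_nonneg (dist y a - dist y b), dist_nonneg (x := a) (y := b)]

theorem IsFrechetMean.isKarcherMean {n : ℕ} {s : Fin n → Y} {c : Y} (h : IsFrechetMean n s c) :
    IsKarcherMean n s c :=
  Eventually.of_forall h

theorem IsGeodesic.isCircumcenter_mid {γ : ℝ → Y} {a b : Y} (h : IsGeodesic γ a b) :
    IsCircumcenter 2 ![a, b] (γ (dist a b / 2)) := by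
  obtain ⟨e1, e2⟩ := h.dist_mid
  refine ⟨dist a b / 2, ?_, fun c' r' h' => ?_⟩
  · rintro _ ⟨i, rfl⟩
    fin_cases i
    · exact Metric.mem_closedBall'.2 e1.le
    · exact Metric.mem_closedBall'.2 e2.le
  · have h0 : dist a c' ≤ r' := h' ⟨0, rfl⟩
    have h1 : dist b c' ≤ r' := h' ⟨1, rfl⟩
    linarith [dist_triangle_right a b c']

theorem IsGeodesic.isCentroid_mid {γ : ℝ → Y} {a b : Y} (h : IsGeodesic γ a b) :
    IsCentroid 2 ![a, b] (γ (dist a b / 2)) :=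
  ⟨γ, h, rfl⟩

/-- Any notion of average that accepts all geodesic midpoints for two points accepts two opposite
corners of a square. -/
theorem HasTaxicabSquaresAt.not_averagesLocallyUniqueAt {p : Y} (hp : HasTaxicabSquaresAt p)
    {avg : (n : ℕ) → (Fin n → Y) → Y → Prop}
    (havg : ∀ (γ : ℝ → Y) (a b : Y), IsGeodesic γ a b → avg 2 ![a, b] (γ (dist a b / 2))) :
    ¬ AveragesLocallyUniqueAt avg p := by
  rintro ⟨U, hU, h⟩
  obtain ⟨a, ha, b, hb, γ, γ', hγ, hγ', hγU, hγU', hne⟩ := hp.exists_bigon hU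
  refine hne (h 2 one_le_two ![a, b] ?_ _ (hγU _) _ (hγU' _) (havg _ _ _ hγ) (havg _ _ _ hγ'))
  intro i
  fin_cases i
  exacts [ha, hb]

theorem everywhereIllPosed_of_hasTaxicabSquaresAt (h : ∀ p : Y, HasTaxicabSquaresAt p) :
    EverywhereIllPosed Y := by
  refine fun p => ⟨(h p).curvatureUnboundedAt, ?_,
    (h p).not_averagesLocallyUniqueAt fun _ _ _ hγ => hγ.isFrechetMean_mid,
    (h p).not_averagesLocallyUniqueAt fun _ _ _ hγ => hγ.isFrechetMean_mid.isKarcherMean,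
    (h p).not_averagesLocallyUniqueAt fun _ _ _ hγ => hγ.isCircumcenter_mid,
    (h p).not_averagesLocallyUniqueAt fun _ _ _ hγ => hγ.isCentroid_mid⟩
  rintro ⟨U, hU, hu⟩
  obtain ⟨a, ha, b, hb, γ, γ', hγ, hγ', hγU, hγU', hne⟩ := (h p).exists_bigon hU
  have hd : 0 ≤ dist a b := dist_nonneg
  exact hne (hu a b γ γ' hγ hγ' (fun t _ => hγU t) (fun t _ => hγU' t) _
    ⟨by linarith, by linarith⟩)

end Taxicab

end MetricGeometry

noncomputable section

namespace TreeShape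

variable {T : BinaryTree} {d n : ℕ} {p : ℝ≥0∞}

theorem notMem_supp {x : PreShape T d n p} {e : T.Edge} : e ∉ x.supp ↔ x e = 0 :=
  not_not

/-! ### Equivalent pre-shapes differ by a permutation of coordinates -/

section Reindex

variable [Fact (1 ≤ p)]

/-- The permutation of coordinates by `σ`. -/
def reindex (σ : Equiv.Perm T.Edge) : PreShape T d n p ≃ₗᵢ[ℝ] PreShape T d n p :=
  LinearIsometryEquiv.piLpCongrLeft p ℝ (Attr d n) σ

theorem reindex_apply (σ : Equiv.Perm T.Edge) (x : PreShape T d n p) (e : T.Edge) :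
    reindex σ x (σ e) = x e := by
  simp [reindex, LinearIsometryEquiv.piLpCongrLeft_apply]

theorem eq_reindex {σ : Equiv.Perm T.Edge} {x y : PreShape T d n p} (h : ∀ e, y (σ e) = x e) :
    y = reindex σ x := by
  ext1 e
  obtain ⟨e, rfl⟩ := σ.surjective e
  rw [h, reindex_apply]

theorem mem_supp_reindex {σ : Equiv.Perm T.Edge} {x : PreShape T d n p} {e : T.Edge} :
    σ e ∈ (reindex σ x).supp ↔ e ∈ x.supp := by
  change reindex σ x (σ e) ≠ 0 ↔ x e ≠ 0
  rw [reindex_apply]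

theorem supp_reindex (σ : Equiv.Perm T.Edge) (x : PreShape T d n p) :
    (reindex σ x).supp = σ '' x.supp := by
  ext e
  obtain ⟨e, rfl⟩ := σ.surjective e
  rw [mem_supp_reindex, σ.injective.mem_set_image]

theorem reindex_supp_subset {σ : Equiv.Perm T.Edge} {u x : PreShape T d n p} :
    (reindex σ u).supp ⊆ (reindex σ x).supp ↔ u.supp ⊆ x.supp := by
  rw [supp_reindex, supp_reindex, image_subset_image_iff σ.injective]

theorem reindex_supp_eq {σ : Equiv.Perm T.Edge} {u x : PreShape T d n p} :
    (reindex σ u).supp = (reindex σ x).supp ↔ u.supp = x.supp := by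
  rw [supp_reindex, supp_reindex, image_eq_image σ.injective]

theorem reindex_mul (σ τ : Equiv.Perm T.Edge) (x : PreShape T d n p) :
    reindex (σ * τ) x = reindex σ (reindex τ x) :=
  (eq_reindex fun e => by rw [Equiv.Perm.mul_apply, reindex_apply, reindex_apply]).symm

theorem exists_reindex_eq (σ : Equiv.Perm T.Edge) (x : PreShape T d n p) :
    ∃ u, reindex σ u = x :=
  (reindex σ).surjective x

/-- Equivalent pre-shapes differ by a permutation of coordinates, which also takes all further
collapsed pre-shapes to equivalent ones. -/
theorem exists_reindex_of_equiv {x y : PreShape T d n p} (h : unorderedSetoid T d n p x y) :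
    ∃ σ : Equiv.Perm T.Edge, y = reindex σ x ∧
      ∀ u : PreShape T d n p, u.supp ⊆ x.supp → unorderedSetoid T d n p u (reindex σ u) := by
  classical
  have h' : Relation.EqvGen (fun x y => SameOrderedShape x y ∨ IsReorderingOf x y) x y := h
  clear h
  induction h' with
  | rel x y h =>
    rcases h with ⟨φ, ⟨h1, h2⟩, hφ⟩ | ⟨g, hg, hxy⟩
    -- The bijection of supports extends to a permutation of all edges. The extension is arbitrary
    -- outside `x.supp`, but maps the complement to the complement, where all attributes vanish.
    -- Order and ancestry are preserved on `x.supp`, hence on every smaller support.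
    · let ψ : {e // e ∈ x.supp} ≃ {e // e ∈ y.supp} := φ
      have hσ : ∀ e (he : e ∈ x.supp), ψ.extendSubtype e = (φ ⟨e, he⟩).1 := fun e he =>
        Equiv.extendSubtype_apply_of_mem ψ e he
      refine ⟨ψ.extendSubtype, eq_reindex fun e => ?_, fun u hu => ?_⟩
      · by_cases he : e ∈ x.supp
        · rw [hσ e he, hφ]
        · have := Equiv.extendSubtype_not_mem ψ e he
          rw [notMem_supp.1 he]
          exact notMem_supp.1 this
      · refine Relation.EqvGen.rel _ _ (Or.inl
          ⟨ψ.extendSubtype.subtypeEquiv fun e => mem_supp_reindex.symm, ⟨?_, ?_⟩, ?_⟩)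
        · intro e f
          have := h1 ⟨e.1, hu e.2⟩ ⟨f.1, hu f.2⟩
          rwa [← hσ, ← hσ] at this
        · intro e f
          have := h2 ⟨e.1, hu e.2⟩ ⟨f.1, hu f.2⟩
          rwa [← hσ, ← hσ] at this
        · exact fun e => reindex_apply _ _ _
    · exact ⟨g, eq_reindex hxy, fun u _ =>
        Relation.EqvGen.rel _ _ (Or.inr ⟨g, hg, reindex_apply g u⟩)⟩
  | refl x =>
    have h1 : ∀ u : PreShape T d n p, u = reindex 1 u := fun u => eq_reindex fun e => rfl
    exact ⟨1, h1 x, fun u _ => by rw [← h1]⟩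
  | symm x y _ ih =>
    obtain ⟨σ, rfl, hσ⟩ := ih
    have h1 : ∀ u : PreShape T d n p, reindex σ⁻¹ (reindex σ u) = u := fun u => by
      rw [← reindex_mul, inv_mul_cancel]
      exact (eq_reindex fun e => rfl).symm
    refine ⟨σ⁻¹, (h1 x).symm, fun u hu => ?_⟩
    obtain ⟨v, rfl⟩ := exists_reindex_eq σ u
    rw [h1]
    exact Setoid.symm' _ (hσ v (reindex_supp_subset.1 hu))
  | trans x y z _ _ ih1 ih2 =>
    obtain ⟨σ, rfl, hσ⟩ := ih1
    obtain ⟨τ, rfl, hτ⟩ := ih2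
    refine ⟨τ * σ, (reindex_mul _ _ _).symm, fun u hu => ?_⟩
    rw [reindex_mul]
    exact Setoid.trans' _ (hσ u hu) (hτ _ (reindex_supp_subset.2 hu))

theorem ncard_supp_eq_of_equiv {x y : PreShape T d n p} (h : unorderedSetoid T d n p x y) :
    y.supp.ncard = x.supp.ncard := by
  obtain ⟨σ, rfl, -⟩ := exists_reindex_of_equiv h
  rw [supp_reindex, ncard_image_of_injective _ σ.injective]

theorem norm_apply_sub_le (x y : PreShape T d n p) (e : T.Edge) : ‖x e - y e‖ ≤ dist x y := by
  rw [dist_eq_norm]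
  exact PiLp.norm_apply_le (x - y) e

end Reindex

/-! ### Perturbation to prescribed edges with different attributes -/

section Perturbation

theorem eventually_add_smul_ne_zero {E : Type*} [NormedAddCommGroup E] [NormedSpace ℝ E] {v w : E}
    (h : v ≠ 0 ∨ w ≠ 0) : ∀ᶠ t : ℝ in 𝓝[≠] 0, v + t • w ≠ 0 := by
  by_cases hv : v = 0
  · filter_upwards [self_mem_nhdsWithin] with t ht
    rw [hv, zero_add]
    exact smul_ne_zero ht (h.resolve_left (not_not.2 hv))
  · have hc : ContinuousAt (fun t : ℝ => v + t • w) 0 := by fun_prop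
    exact (hc.eventually_ne (by simpa using hv)).filter_mono nhdsWithin_le_nhds

/-- The assumptions `1 ≤ d` and `1 ≤ n` enter only here, to make the attribute space nonzero. -/
theorem exists_attr_norm_one (hd : 1 ≤ d) (hn : 1 ≤ n) : ∃ v : Attr d n, ‖v‖ = 1 := by
  refine ⟨PiLp.single 2 ⟨0, hn⟩ (PiLp.single 2 ⟨0, hd⟩ 1), ?_⟩
  rw [PiLp.norm_single, PiLp.norm_single, norm_one]

variable [Fact (1 ≤ p)]

/-- Every pre-shape can be perturbed so that prescribed further edges appear and all edges have
different attributes. -/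
theorem exists_supp_eq_injOn (hd : 1 ≤ d) (hn : 1 ≤ n) (y : PreShape T d n p) {F : Set T.Edge}
    (hF : y.supp ⊆ F) {ε : ℝ} (hε : 0 < ε) :
    ∃ u : PreShape T d n p, u.supp = F ∧ InjOn u F ∧ dist u y < ε := by
  classical
  obtain ⟨v, hv⟩ := exists_attr_norm_one hd hn
  have hv0 : v ≠ 0 := fun h => by simp [h] at hv
  -- The perturbation direction has different nonzero multiples of one vector as attributes on `F`.
  -- Each unwanted coincidence then excludes all but nonzero small `t` only at finitely many values,
  -- so small `t ≠ 0` avoid all of them.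
  let c : T.Edge → ℝ := fun e => (Fintype.equivFin T.Edge e : ℕ) + 1
  have hc : ∀ e, c e ≠ 0 := fun e => by positivity
  have hcinj : ∀ e f, c e = c f → e = f := fun e f h => by
    have : ((Fintype.equivFin T.Edge e : ℕ) : ℝ) = (Fintype.equivFin T.Edge f : ℕ) :=
      add_right_cancel h
    exact (Fintype.equivFin T.Edge).injective (Fin.ext (Nat.cast_injective this))
  let w : PreShape T d n p := WithLp.toLp p fun e => if e ∈ F then c e • v else 0
  have hw : ∀ e ∈ F, w e = c e • v := fun e he => if_pos he
  have hw' : ∀ e ∉ F, w e = 0 := fun e he => if_neg he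
  have h1 : ∀ᶠ t : ℝ in 𝓝[≠] 0, ∀ e : T.Edge, e ∈ F → y e + t • w e ≠ 0 :=
    eventually_all.2 fun e => by
      by_cases he : e ∈ F
      · filter_upwards [eventually_add_smul_ne_zero (v := y e) (w := w e)
          (Or.inr (by rw [hw e he]; exact smul_ne_zero (hc e) hv0))] with t ht _
        exact ht
      · exact Eventually.of_forall fun t h => absurd h he
  have h2 : ∀ᶠ t : ℝ in 𝓝[≠] 0, ∀ e f : T.Edge, e ∈ F → f ∈ F → e ≠ f →
      (y e - y f) + t • (w e - w f) ≠ 0 :=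
    eventually_all.2 fun e => eventually_all.2 fun f => by
      by_cases hef : e ∈ F ∧ f ∈ F ∧ e ≠ f
      · obtain ⟨he, hf, hne⟩ := hef
        filter_upwards [eventually_add_smul_ne_zero (v := y e - y f) (w := w e - w f)
          (Or.inr (by
            rw [hw e he, hw f hf, ← sub_smul]
            exact smul_ne_zero (sub_ne_zero.2 fun h => hne (hcinj _ _ h)) hv0))] with t ht _ _ _
        exact ht
      · exact Eventually.of_forall fun t a b c => absurd ⟨a, b, c⟩ hef
  have h3 : ∀ᶠ t : ℝ in 𝓝[≠] 0, dist (y + t • w) y < ε := by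
    have hcont : ContinuousAt (fun t : ℝ => |t| * ‖w‖) 0 := by fun_prop
    filter_upwards [(hcont.eventually_lt continuousAt_const
      (by simpa using hε)).filter_mono nhdsWithin_le_nhds] with t ht
    rwa [dist_eq_norm, add_sub_cancel_left, norm_smul, Real.norm_eq_abs]
  obtain ⟨t, ht1, ht2, ht3⟩ := (h1.and (h2.and h3)).exists
  refine ⟨y + t • w, ?_, ?_, ht3⟩
  · ext e
    by_cases he : e ∈ F
    · exact iff_of_true (ht1 e he) he
    · refine iff_of_false (fun h => h ?_) he
      have hy : y e = 0 := notMem_supp.1 fun h => he (hF h)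
      change y e + t • w e = 0
      rw [hy, hw' e he, smul_zero, add_zero]
  · intro e he f hf hef
    by_contra hne
    refine ht2 e f he hf hne ?_
    rw [smul_sub, ← add_sub_add_comm]
    exact sub_eq_zero.2 hef

end Perturbation

/-! ### Lifting short chains, and local charts -/

section Charts

variable {Θ : Topologies T} {m : InducedMetric}

theorem mem_preShapes_of_supp_subset {x y : PreShape T d n p} (hy : y ∈ preShapes Θ d n p)
    (h : x.supp ⊆ y.supp) : x ∈ preShapes Θ d n p := by
  obtain ⟨F, hF, hyF⟩ := hy
  exact ⟨F, hF, h.trans hyF⟩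

theorem mk_eq_mk_iff {x y : preShapes Θ d n p} :
    UnorderedSpace.mk m x = UnorderedSpace.mk m y ↔ unorderedSetoid T d n p x.1 y.1 :=
  Quotient.eq

/-- Pre-shapes supported in `z.supp` form a linear subspace contained in `Z`. -/
theorem isLeg_of_supp_subset {x y z : PreShape T d n p} (hz : z ∈ preShapes Θ d n p)
    (hx : x.supp ⊆ z.supp) (hy : y.supp ⊆ z.supp) : IsLeg m (preShapes Θ d n p) x y := by
  cases m with
  | restricted => trivial
  | length =>
    rintro _ ⟨s, t, -, -, -, rfl⟩
    refine mem_preShapes_of_supp_subset hz fun e he => ?_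
    by_contra hze
    refine he ?_
    have h1 : x e = 0 := notMem_supp.1 fun h => hze (hx h)
    have h2 : y e = 0 := notMem_supp.1 fun h => hze (hy h)
    change s • x e + t • y e = 0
    rw [h1, h2, smul_zero, smul_zero, add_zero]

variable [Fact (1 ≤ p)]

theorem dist_le_of_isChain {a b : UnorderedSpace T Θ m d n p} {L : ℝ} (h : IsChain a b L) :
    dist a b ≤ L :=
  csInf_le ⟨0, fun _ h => IsChain.nonneg h⟩ h

theorem exists_isChain_lt {a b : UnorderedSpace T Θ m d n p} {r : ℝ} (h : dist a b < r) :
    ∃ L < r, IsChain a b L := by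
  obtain ⟨L, hL, hLr⟩ := exists_lt_of_csInf_lt (IsChain.exists_chain a b) h
  exact ⟨L, hLr, hL⟩

theorem dist_mk_le {x y z : preShapes Θ d n p} (hx : x.1.supp ⊆ z.1.supp)
    (hy : y.1.supp ⊆ z.1.supp) :
    dist (UnorderedSpace.mk m x) (UnorderedSpace.mk m y) ≤ dist x.1 y.1 := by
  have := IsChain.cons x y _ 0 (isLeg_of_supp_subset (m := m) z.2 hx hy) (.refl _)
  rw [add_zero] at this
  exact dist_le_of_isChain this

/-- No edges can be added to any pre-shape in `Z` that represents the same tree-shape as `x`. -/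
def IsMaximal (Θ : Topologies T) (x : PreShape T d n p) : Prop :=
  ∀ z ∈ preShapes Θ d n p, unorderedSetoid T d n p x z →
    ∀ w ∈ preShapes Θ d n p, z.supp ⊆ w.supp → w.supp = z.supp

/-- Collapsing an edge of `x` costs at least the norm of its attribute. -/
theorem supp_subset_of_dist_lt {x y : PreShape T d n p} {ρ : ℝ} (hρ : ∀ e ∈ x.supp, ρ ≤ ‖x e‖)
    (h : dist y x < ρ) : x.supp ⊆ y.supp := by
  intro e he hy
  have h1 := norm_apply_sub_le y x e
  rw [hy, zero_sub, norm_neg] at h1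
  linarith [hρ e he]

/-- Short chains that start near a maximal pre-shape can be lifted to a neighbourhood of it. -/
theorem IsChain.exists_lift {x : preShapes Θ d n p} (hx : IsMaximal Θ x.1) {ρ : ℝ}
    (hρ : ∀ e ∈ x.1.supp, ρ ≤ ‖x.1 e‖) {a b : UnorderedSpace T Θ m d n p} {L : ℝ}
    (h : IsChain a b L) (u : preShapes Θ d n p) (hu : u.1.supp = x.1.supp)
    (hua : UnorderedSpace.mk m u = a) (hL : dist u.1 x.1 + L < ρ) :
    ∃ v : preShapes Θ d n p, v.1.supp = x.1.supp ∧ UnorderedSpace.mk m v = b ∧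
      dist u.1 v.1 ≤ L := by
  induction h generalizing u with
  | refl a => exact ⟨u, hu, hua, (dist_self _).le⟩
  | cons x' y' b L _ hch ih =>
    have hL0 := hch.nonneg
    -- The next leg starts at `x' = reindex σ u`. It stays close to `reindex σ x.1`, which still
    -- represents the class of `x`, so maximality fixes the support of `y'`. Pulling `y'` back by
    -- `σ` then continues the lift from `u` by a step of the same length.
    obtain ⟨σ, hσ, hσ'⟩ := exists_reindex_of_equiv (mk_eq_mk_iff.1 hua)
    have hz : reindex σ x.1 ∈ preShapes Θ d n p :=
      mem_preShapes_of_supp_subset x'.2 (by rw [hσ, reindex_supp_subset, hu])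
    have hdz : dist y'.1 (reindex σ x.1) ≤ dist x'.1 y'.1 + dist u.1 x.1 := by
      refine (dist_triangle _ x'.1 _).trans_eq ?_
      rw [dist_comm y'.1, hσ, (reindex σ).dist_map]
    have hsub : (reindex σ x.1).supp ⊆ y'.1.supp := by
      refine supp_subset_of_dist_lt (ρ := ρ) ?_ (by linarith)
      intro e he
      obtain ⟨e, rfl⟩ := σ.surjective e
      rw [reindex_apply]
      exact hρ e (mem_supp_reindex.1 he)
    have hsupp := hx _ hz (hσ' x.1 hu.ge) _ y'.2 hsub
    obtain ⟨u', hu'⟩ := exists_reindex_eq σ y'.1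
    have hu's : u'.supp = x.1.supp := by rw [← hu', reindex_supp_eq] at hsupp; exact hsupp
    have hdu : dist u' x.1 = dist y'.1 (reindex σ x.1) := by rw [← hu', (reindex σ).dist_map]
    have hduu : dist u.1 u' = dist x'.1 y'.1 := by rw [← hu', hσ, (reindex σ).dist_map]
    obtain ⟨v, hv, hvb, hdv⟩ := ih ⟨u', mem_preShapes_of_supp_subset x.2 hu's.le⟩ hu's
      (mk_eq_mk_iff.2 (by rw [← hu']; exact hσ' u' (by rw [hu's, hu])))
      (by change dist u' x.1 + L < ρ; linarith)
    exact ⟨v, hv, hvb, (dist_triangle _ u' _).trans (by rw [hduu]; linarith)⟩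

/-- The tree-shape space near `x` is isometric to the coordinate subspace of the edges of `x`. -/
def HasChartAt (m : InducedMetric) (x : preShapes Θ d n p) (r : ℝ) : Prop :=
  (∀ u v : preShapes Θ d n p, u.1.supp ⊆ x.1.supp → v.1.supp ⊆ x.1.supp →
    dist u.1 x.1 < r → dist v.1 x.1 < r →
      dist (UnorderedSpace.mk m u) (UnorderedSpace.mk m v) = dist u.1 v.1) ∧
  ∀ b : UnorderedSpace T Θ m d n p, dist b (UnorderedSpace.mk m x) < r →
    ∃ v : preShapes Θ d n p, v.1.supp ⊆ x.1.supp ∧ UnorderedSpace.mk m v = b ∧ dist v.1 x.1 < r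

theorem exists_pos_forall_le {ι : Type*} [Finite ι] (f : ι → ℝ) (hf : ∀ i, 0 < f i) :
    ∃ ρ > 0, ∀ i, ρ ≤ f i := by
  have h : ∀ᶠ ρ in 𝓝[>] (0 : ℝ), ∀ i, ρ ≤ f i := eventually_all.2 fun i =>
    (eventually_le_nhds (hf i)).filter_mono nhdsWithin_le_nhds
  obtain ⟨ρ, h1, h2⟩ := (h.and self_mem_nhdsWithin).exists
  exact ⟨ρ, h2, h1⟩

theorem IsMaximal.exists_hasChartAt {x : preShapes Θ d n p} (hx : IsMaximal Θ x.1)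
    (hinj : InjOn x.1 x.1.supp) : ∃ r > 0, HasChartAt m x r := by
  obtain ⟨ρ₁, hρ₁, h1⟩ := exists_pos_forall_le (fun e : x.1.supp => ‖x.1 e.1‖)
    fun e => norm_pos_iff.2 e.2
  obtain ⟨ρ₂, hρ₂, h2⟩ := exists_pos_forall_le
    (fun e : {e : x.1.supp × x.1.supp // e.1 ≠ e.2} => ‖x.1 e.1.1.1 - x.1 e.1.2.1‖)
    fun e => norm_pos_iff.2 (sub_ne_zero.2 fun h => e.2 (Subtype.ext (hinj e.1.1.2 e.1.2.2 h)))
  obtain ⟨ρ, hρ, hρ₁', hρ₂'⟩ : ∃ ρ > 0, ρ ≤ ρ₁ ∧ ρ ≤ ρ₂ :=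
    ⟨min ρ₁ ρ₂, lt_min hρ₁ hρ₂, min_le_left _ _, min_le_right _ _⟩
  have h1' : ∀ e ∈ x.1.supp, ρ ≤ ‖x.1 e‖ := fun e he => hρ₁'.trans (h1 ⟨e, he⟩)
  have h2' : ∀ e ∈ x.1.supp, ∀ f ∈ x.1.supp, ‖x.1 e - x.1 f‖ < ρ → e = f := by
    intro e he f hf hlt
    by_contra hne
    exact absurd hlt (not_lt.2 (hρ₂'.trans (h2 ⟨(⟨e, he⟩, ⟨f, hf⟩), fun h => hne
      (congrArg Subtype.val h)⟩)))
  refine ⟨ρ / 4, by positivity, ?_, ?_⟩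
  · intro u v hu hv hux hvx
    have hu' : u.1.supp = x.1.supp := hu.antisymm (supp_subset_of_dist_lt h1' (by linarith))
    refine le_antisymm (dist_mk_le hu hv) (not_lt.1 fun hlt => ?_)
    obtain ⟨L, hLlt, hL⟩ := exists_isChain_lt hlt
    have huv : dist u.1 v.1 < ρ / 2 := by linarith [dist_triangle_right u.1 v.1 x.1]
    obtain ⟨w, hw, hwv, hdw⟩ := hL.exists_lift hx h1' u hu' rfl (by linarith)
    obtain ⟨σ, hσ, -⟩ := exists_reindex_of_equiv (mk_eq_mk_iff.1 hwv.symm)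
    -- The radius `ρ / 4` is chosen for this: `w` is within `ρ / 4 + ρ / 2` of `x`, and `v` within
    -- `ρ / 4`. Since `w` has at `σ e` the attribute of `v` at `e`, those of `x` at `σ e` and `e`
    -- differ by less than `ρ`, so `σ e = e`.
    have hwx : dist w.1 x.1 < 3 * ρ / 4 := by
      linarith [dist_triangle_left w.1 x.1 u.1]
    have hfix : ∀ e ∈ x.1.supp, σ e = e := by
      intro e he
      have hev : e ∈ v.1.supp := supp_subset_of_dist_lt h1' (by linarith) he
      have hσe : σ e ∈ x.1.supp := by rw [← hw, hσ]; exact mem_supp_reindex.2 hev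
      refine h2' _ hσe _ he ?_
      have e1 : w.1 (σ e) = v.1 e := by rw [hσ, reindex_apply]
      have e2 := norm_apply_sub_le w.1 x.1 (σ e)
      have e3 := norm_apply_sub_le v.1 x.1 e
      have e4 : x.1 (σ e) - x.1 e = (v.1 e - x.1 e) - (w.1 (σ e) - x.1 (σ e)) := by
        rw [e1]; abel
      rw [e4]
      exact (norm_sub_le _ _).trans_lt (by linarith)
    have hwv' : w.1 = v.1 := by
      ext1 e
      by_cases he : e ∈ x.1.supp
      · nth_rewrite 1 [← hfix e he]
        rw [hσ, reindex_apply]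
      · have e1 : w.1 e = 0 := notMem_supp.1 fun h => he (hw.le h)
        have e2 : v.1 e = 0 := notMem_supp.1 fun h => he (hv h)
        rw [e1, e2]
    rw [hwv'] at hdw
    linarith
  · intro b hb
    rw [dist_comm] at hb
    obtain ⟨L, hLlt, hL⟩ := exists_isChain_lt hb
    obtain ⟨v, hv, hvb, hdv⟩ := hL.exists_lift hx h1' x rfl rfl (by rw [dist_self]; linarith)
    exact ⟨v, hv.le, hvb, by rw [dist_comm]; linarith⟩

/-- Charts exist near every point, around pre-shapes with as many edges as there are nearby. -/
theorem exists_hasChartAt_near (hd : 1 ≤ d) (hn : 1 ≤ n) (a : UnorderedSpace T Θ m d n p) {ε : ℝ}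
    (hε : 0 < ε) : ∃ x : preShapes Θ d n p, dist (UnorderedSpace.mk m x) a < ε ∧
      (∃ r > 0, HasChartAt m x r) ∧
      ∀ y : preShapes Θ d n p, dist (UnorderedSpace.mk m y) a < ε →
        y.1.supp.ncard ≤ x.1.supp.ncard := by
  let S : Set ℕ := {k | ∃ y : preShapes Θ d n p, dist (UnorderedSpace.mk m y) a < ε ∧
    y.1.supp.ncard = k}
  have hne : S.Nonempty := by
    obtain ⟨y, rfl⟩ := Quotient.exists_rep a
    exact ⟨_, y, (dist_self (UnorderedSpace.mk m y)).trans_lt hε, rfl⟩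
  have hbdd : BddAbove S := by
    refine ⟨Nat.card T.Edge, ?_⟩
    rintro _ ⟨y, -, rfl⟩
    exact (ncard_le_ncard (subset_univ _)).trans_eq (ncard_univ _)
  obtain ⟨y, hy, hycard⟩ := Nat.sSup_mem hne hbdd
  have hmax : ∀ z : preShapes Θ d n p, dist (UnorderedSpace.mk m z) a < ε →
      z.1.supp.ncard ≤ y.1.supp.ncard := fun z hz => by
    rw [hycard]
    exact le_csSup hbdd ⟨z, hz, rfl⟩
  have perturb : ∀ (z w : preShapes Θ d n p), z.1.supp ⊆ w.1.supp →
      dist (UnorderedSpace.mk m z) a < ε → ∃ u : preShapes Θ d n p, u.1.supp = w.1.supp ∧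
        InjOn u.1 w.1.supp ∧ dist (UnorderedSpace.mk m u) a < ε := by
    intro z w hzw hz
    obtain ⟨u, hu, huinj, huz⟩ := exists_supp_eq_injOn hd hn z.1 hzw (sub_pos.2 hz)
    refine ⟨⟨u, mem_preShapes_of_supp_subset w.2 hu.le⟩, hu, huinj, ?_⟩
    have := dist_mk_le (m := m) (x := ⟨u, mem_preShapes_of_supp_subset w.2 hu.le⟩) (y := z)
      (z := w) hu.le hzw
    exact (dist_triangle _ (UnorderedSpace.mk m z) _).trans_lt (by linarith)
  obtain ⟨x, hx, hxinj, hxa⟩ := perturb y y subset_rfl hy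
  rw [← hx] at hxinj
  refine ⟨x, hxa, IsMaximal.exists_hasChartAt ?_ hxinj, by rwa [hx]⟩
  -- If edges could be added to `z`, a small perturbation would realize them within `ε` of `a`,
  -- against the maximal edge count.
  intro z hz hxz w hw hzw
  obtain ⟨u, hu, -, hua⟩ := perturb ⟨z, hz⟩ ⟨w, hw⟩ hzw (by
    rwa [← mk_eq_mk_iff (x := x) (y := ⟨z, hz⟩) (m := m) |>.2 hxz])
  refine (eq_of_subset_of_ncard_le hzw ?_).symm
  have := hmax u hua
  rwa [hu, ← hx, ← ncard_supp_eq_of_equiv hxz] at this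

end Charts

/-! ### QED: charts are Euclidean -/

section QED

variable {Θ : Topologies T} {m : InducedMetric}

/-- In the chart, a ball that fits into the chart ball becomes a Euclidean ball intersected with a
coordinate subspace and the chart ball, which is convex. -/
theorem HasChartAt.isCAT_ball {x : preShapes Θ d n 2} {r : ℝ} (hx : HasChartAt m x r)
    {q : UnorderedSpace T Θ m d n 2} {r' : ℝ}
    (hq : dist q (UnorderedSpace.mk m x) + r' ≤ r) :
    MetricGeometry.IsCAT (Metric.ball q r') 0 := by
  have hlift : ∀ b : Metric.ball q r', ∃ v : preShapes Θ d n 2, v.1.supp ⊆ x.1.supp ∧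
      UnorderedSpace.mk m v = b.1 ∧ dist v.1 x.1 < r := fun b =>
    hx.2 b.1 ((dist_triangle _ q _).trans_lt (by linarith [Metric.mem_ball.1 b.2]))
  choose f hf1 hf2 hf3 using hlift
  have hiso : Isometry fun b => (f b).1 := Isometry.of_dist_eq fun b c => by
    rw [← hx.1 _ _ (hf1 b) (hf1 c) (hf3 b) (hf3 c), hf2, hf2, Subtype.dist_eq]
  refine MetricGeometry.isCAT_zero_of_isometry hiso (fun b c hbc => ?_) ?_
  · exact Subtype.ext (by rw [← hf2 b, ← hf2 c, Subtype.ext hbc])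
  · rintro _ ⟨b, rfl⟩ _ ⟨c, rfl⟩
    refine fun s t hs ht hst => ?_
    have hr' : 0 < r' := Metric.pos_of_mem_ball b.2
    obtain ⟨u, hu, rfl, hux⟩ := hx.2 q (by linarith)
    have hmem : ∀ b, (f b).1 ∈ Metric.ball u.1 r' := fun b => by
      rw [Metric.mem_ball, ← hx.1 _ _ (hf1 b) hu (hf3 b) hux, hf2]
      exact b.2
    obtain ⟨w, hw⟩ : ∃ w, w = s • (f b).1 + t • (f c).1 := ⟨_, rfl⟩
    have hwr : dist w x.1 < r := by
      rw [hw]; exact convex_ball x.1 r (hf3 b) (hf3 c) hs ht hst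
    have hwu : dist w u.1 < r' := by
      rw [hw]; exact convex_ball u.1 r' (hmem b) (hmem c) hs ht hst
    have hwx : w.supp ⊆ x.1.supp := fun e he => by
      by_contra hxe
      refine he ?_
      rw [hw]
      change s • (f b).1 e + t • (f c).1 e = 0
      rw [notMem_supp.1 fun h => hxe (hf1 b h), notMem_supp.1 fun h => hxe (hf1 c h), smul_zero,
        smul_zero, add_zero]
    let w' : preShapes Θ d n 2 := ⟨w, mem_preShapes_of_supp_subset x.2 hwx⟩
    have hwq : UnorderedSpace.mk m w' ∈ Metric.ball (UnorderedSpace.mk m u) r' := by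
      rw [Metric.mem_ball, hx.1 w' u hwx hu hwr hux]
      exact hwu
    refine ⟨⟨_, hwq⟩, ?_⟩
    rw [← hw]
    -- The chosen lift of the class of `w` is `w` itself, because the chart preserves distances.
    refine dist_eq_zero.1 ?_
    rw [← hx.1 _ w' (hf1 _) hwx (hf3 _) hwr, hf2, dist_self]

theorem genericallyNonpositivelyCurved (hd : 1 ≤ d) (hn : 1 ≤ n) :
    MetricGeometry.GenericallyNonpositivelyCurved (UnorderedSpace T Θ m d n 2) := by
  refine ⟨{q | ∃ (x : preShapes Θ d n 2) (r : ℝ), HasChartAt m x r ∧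
    dist q (UnorderedSpace.mk m x) < r}, ?_, ?_, ?_⟩
  · simp only [ofPred_exists, ofPred_and]
    refine isOpen_iUnion fun x => isOpen_iUnion fun r => isOpen_const.inter ?_
    exact Metric.isOpen_ball
  · refine Metric.dense_iff.2 fun a ε hε => ?_
    obtain ⟨x, hxa, ⟨r, hr, hx⟩, -⟩ := exists_hasChartAt_near hd hn a hε
    exact ⟨UnorderedSpace.mk m x, hxa, x, r, hx, by rwa [dist_self]⟩
  · rintro q ⟨x, r, hx, hq⟩
    exact ⟨r - dist q (UnorderedSpace.mk m x), sub_pos.2 hq, hx.isCAT_ball (by linarith)⟩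

end QED

/-! ### TED: charts contain `ℓ¹` squares -/

section TED

variable {Θ : Topologies T} {m : InducedMetric}

/-- Trees with at most one edge can be represented with a prescribed edge. -/
theorem exists_equiv_supp_subset [Fact (1 ≤ p)] {x : PreShape T d n p} (hx : x.supp.ncard ≤ 1)
    {F : Set T.Edge} (hF : F.Nonempty) :
    ∃ y : PreShape T d n p, unorderedSetoid T d n p x y ∧ y.supp ⊆ F := by
  classical
  rcases eq_or_ne x.supp ∅ with h0 | h0
  · exact ⟨x, Setoid.refl' _ _, h0.trans_subset (empty_subset _)⟩
  · obtain ⟨e, he⟩ := ncard_eq_one.1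
      (le_antisymm hx (Nat.one_le_iff_ne_zero.2 fun h => h0 ((ncard_eq_zero).1 h)))
    obtain ⟨f, hf⟩ := hF
    -- A one-edge tree carries no information about ancestry or order, so its edge may be moved
    -- anywhere.
    let σ : Equiv.Perm T.Edge := Equiv.swap e f
    have hs : (reindex σ x).supp = {f} := by
      rw [supp_reindex, he, image_singleton, Equiv.swap_apply_left]
    have : Subsingleton x.supp := by rw [he]; infer_instance
    refine ⟨reindex σ x, Relation.EqvGen.rel _ _ (Or.inl
      ⟨σ.subtypeEquiv fun e => mem_supp_reindex.symm, ⟨?_, ?_⟩, fun e => reindex_apply _ _ _⟩), ?_⟩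
    · intro a b
      rw [Subsingleton.elim a b]
      exact iff_of_true List.prefix_rfl List.prefix_rfl
    · intro a b
      rw [Subsingleton.elim a b]
      exact iff_of_false (lt_irrefl _) (lt_irrefl _)
    · rw [hs]
      exact singleton_subset_iff.2 hf

/-- `Θ` may have one-edge topologies that are maximal under inclusion. Their trees can still be
represented inside `F`, where a second edge can grow. -/
theorem exists_two_le_ncard_supp_near [Fact (1 ≤ p)] (hd : 1 ≤ d) (hn : 1 ≤ n) {F : Set T.Edge}
    (hF : F ∈ Θ.sets) (hF2 : 2 ≤ F.ncard) (a : UnorderedSpace T Θ m d n p) {ε : ℝ} (hε : 0 < ε) :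
    ∃ y : preShapes Θ d n p, dist (UnorderedSpace.mk m y) a < ε ∧ 2 ≤ y.1.supp.ncard := by
  obtain ⟨x, rfl⟩ : ∃ x, UnorderedSpace.mk m x = a := Quotient.exists_rep a
  by_cases hx : 2 ≤ x.1.supp.ncard
  · exact ⟨x, by rwa [dist_self], hx⟩
  · obtain ⟨y, hxy, hy⟩ := exists_equiv_supp_subset (F := F) (Nat.lt_succ_iff.1 (not_le.1 hx))
      (nonempty_of_ncard_ne_zero (by omega))
    obtain ⟨u, hu, -, huy⟩ := exists_supp_eq_injOn hd hn y hy hε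
    refine ⟨⟨u, F, hF, hu.le⟩, ?_, by rwa [hu]⟩
    rw [mk_eq_mk_iff (m := m) (y := ⟨y, F, hF, hy⟩) |>.2 hxy]
    exact (dist_mk_le (z := ⟨u, F, hF, hu.le⟩) subset_rfl (hy.trans hu.ge)).trans_lt huy

/-- Two edge attributes vary independently along a unit vector; the `ℓ¹` distance adds the two
displacements. -/
theorem HasChartAt.hasTaxicabSquares (hd : 1 ≤ d) (hn : 1 ≤ n) {x : preShapes Θ d n 1} {r : ℝ}
    (hr : 0 < r) (hx : HasChartAt m x r) (h2 : 2 ≤ x.1.supp.ncard) :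
    MetricGeometry.HasTaxicabSquaresAt (UnorderedSpace.mk m x) := by
  classical
  intro ε hε
  obtain ⟨v, hv⟩ := exists_attr_norm_one hd hn
  obtain ⟨e₁, he₁, e₂, he₂, hne⟩ := (one_lt_ncard (toFinite _)).1 h2
  let g : ℝ → ℝ → PreShape T d n 1 := fun s t =>
    WithLp.toLp 1 fun e => x.1 e + (if e = e₁ then s else if e = e₂ then t else 0) • v
  have hdist : ∀ s t s' t', dist (g s t) (g s' t') = |s - s'| + |t - t'| := by
    intro s t s' t'
    have h : ∀ e, dist (g s t e) (g s' t' e) =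
        (if e = e₁ then |s - s'| else 0) + if e = e₂ then |t - t'| else 0 := by
      intro e
      change dist (x.1 e + _ • v) (x.1 e + _ • v) = _
      rw [dist_add_left, dist_eq_norm, ← sub_smul, norm_smul, hv, mul_one, Real.norm_eq_abs]
      by_cases h1 : e = e₁
      · rw [if_pos h1, if_pos h1, if_pos h1, if_neg (h1.trans_ne hne), add_zero]
      · simp only [if_neg h1, zero_add]
        split_ifs <;> simp
    rw [PiLp.dist_eq_of_L1, Finset.sum_congr rfl fun e _ => h e, Finset.sum_add_distrib,
      Finset.sum_ite_eq' Finset.univ e₁, Finset.sum_ite_eq' Finset.univ e₂,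
      if_pos (Finset.mem_univ _), if_pos (Finset.mem_univ _)]
  have hg0 : g 0 0 = x.1 := by
    ext1 e
    change x.1 e + _ • v = x.1 e
    rw [ite_self, ite_self, zero_smul, add_zero]
  have hsupp : ∀ s t, (g s t).supp ⊆ x.1.supp := by
    intro s t e he
    by_contra hxe
    refine he ?_
    change x.1 e + _ • v = 0
    rw [notMem_supp.1 hxe, if_neg (ne_of_mem_of_not_mem he₁ hxe).symm,
      if_neg (ne_of_mem_of_not_mem he₂ hxe).symm, zero_smul, add_zero]
  let f : ℝ → ℝ → UnorderedSpace T Θ m d n 1 := fun s t =>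
    UnorderedSpace.mk m ⟨g s t, mem_preShapes_of_supp_subset x.2 (hsupp s t)⟩
  obtain ⟨δ, hδ, hδε, hδr⟩ : ∃ δ > 0, 2 * δ < ε ∧ 2 * δ < r :=
    ⟨min ε r / 4, by positivity, by linarith [min_le_left ε r], by linarith [min_le_right ε r]⟩
  have hsmall : ∀ s ∈ Icc 0 δ, ∀ t ∈ Icc 0 δ, dist (g s t) x.1 ≤ 2 * δ := by
    intro s hs t ht
    rw [← hg0, hdist, sub_zero, sub_zero, abs_of_nonneg hs.1, abs_of_nonneg ht.1]
    linarith [hs.2, ht.2]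
  refine ⟨δ, hδ, by linarith, f, ?_, fun s hs t ht => ?_⟩
  · intro s hs t ht s' hs' t' ht'
    rw [← hdist]
    exact hx.1 _ _ (hsupp s t) (hsupp s' t') ((hsmall s hs t ht).trans_lt hδr)
      ((hsmall s' hs' t' ht').trans_lt hδr)
  · have h : dist (f s t) (UnorderedSpace.mk m x) ≤ dist (g s t) x.1 :=
      dist_mk_le (m := m) (x := ⟨g s t, mem_preShapes_of_supp_subset x.2 (hsupp s t)⟩) (y := x)
        (z := x) (hsupp s t) subset_rfl
    exact (h.trans (hsmall s hs t ht)).trans_lt hδε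

/-- The chart center has the largest edge count near `a`, and some nearby tree has two edges; so the
chart has at least two edges and contains squares. -/
theorem everywhereIllPosed (hd : 1 ≤ d) (hn : 1 ≤ n)
    (hΘ : ∃ F ∈ Θ.sets, 2 ≤ F.ncard) :
    MetricGeometry.EverywhereIllPosed (UnorderedSpace T Θ m d n 1) := by
  obtain ⟨F, hF, hF2⟩ := hΘ
  refine MetricGeometry.everywhereIllPosed_of_hasTaxicabSquaresAt fun a ε hε => ?_
  obtain ⟨x, hxa, ⟨r, hr, hx⟩, hmax⟩ := exists_hasChartAt_near hd hn a (half_pos hε)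
  obtain ⟨y, hya, hy⟩ := exists_two_le_ncard_supp_near hd hn hF hF2 a (half_pos hε)
  obtain ⟨δ, hδ, hδε, f, hf, hfx⟩ :=
    hx.hasTaxicabSquares hd hn hr (hy.trans (hmax y hya)) (ε / 2) (half_pos hε)
  exact ⟨δ, hδ, by linarith, f, hf, fun s hs t ht =>
    (dist_triangle _ (UnorderedSpace.mk m x) _).trans_lt (by linarith [hfx s hs t ht])⟩

end TED

end TreeShape

end

theorem mainTheorem5 (T : TreeShape.BinaryTree) (d n : ℕ) (hd : 1 ≤ d) (hn : 1 ≤ n) :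
    -- the full unordered tree-shape space, with QED (`p = 2`) and TED (`p = 1`)
    (MetricGeometry.GenericallyNonpositivelyCurved (TreeShape.FullUnorderedSpace T d n 2) ∧
      (2 ≤ T.edges.card →
        MetricGeometry.EverywhereIllPosed (TreeShape.FullUnorderedSpace T d n 1))) ∧
    -- the restricted unordered tree-shape spaces
    (∀ (Θ : TreeShape.Topologies T) (m : TreeShape.InducedMetric),
      MetricGeometry.GenericallyNonpositivelyCurved (TreeShape.UnorderedSpace T Θ m d n 2) ∧
      ((∃ F ∈ Θ.sets, 2 ≤ F.ncard) →
        MetricGeometry.EverywhereIllPosed (TreeShape.UnorderedSpace T Θ m d n 1))) := by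
  -- The full space is the case where the whole edge set is the only topology.
  refine ⟨⟨TreeShape.genericallyNonpositivelyCurved hd hn, fun h =>
    TreeShape.everywhereIllPosed hd hn ⟨univ, rfl, ?_⟩⟩, fun Θ m =>
      ⟨TreeShape.genericallyNonpositivelyCurved hd hn, TreeShape.everywhereIllPosed hd hn⟩⟩
  rw [ncard_univ, Nat.card_eq_fintype_card, Fintype.card_coe]
  exact h
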